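/- For real $\nu$ and $x>0$ let $$I_\nu(x)=\sum_{n=0}^\infty\frac{(x/2)^{2n+\nu}}{n!\,\Gamma(n+\nu+1)},\qquad \mathbf{L}_\nu(x)=\sum_{n=0}^\infty\frac{(x/2)^{2n+\nu+1}}{\Gamma(n+\frac32)\Gamma(n+\nu+\frac32)}$$ be the modified Bessel function and the modified Struve function of the first kind. Write $C(f(x))=xf'(x)/f(x)$ for the condition number of a function $f$ at $x$ and, for $\nu>-\frac32$, put $$a_\nu(x)=\frac{(x/2)^\nu}{\sqrt{\pi}\,\Gamma(\nu+\frac32)},\qquad b_\nu(x)=\frac{x\,a_\nu(x)}{2\mathbf{L}_\nu(x)}.$$ Then the following inequalities hold for all $x>0$. (i) $$C(I_\nu(x))<C(\mathbf{L}_\nu(x))<C(I_\nu(x))+2b_\nu(x),$$ where the lower bound is valid for $\nu\ge\frac12$ and the upper bound is valid for $\nu\ge-\frac12$. (ii) $$\sqrt{(\nu-\tfrac12)^2+x^2}-\tfrac12<C(\mathbf{L}_\nu(x))<\sqrt{(\nu+b_\nu(x))^2+x^2}+b_\nu(x),$$ where the lower bound holds for $\nu\ge\frac12$ and the upper bound holds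 for $\nu\ge-\frac12$; $$\sqrt{(\nu+1+b_{\nu+1}(x))^2+x^2}+2b_\nu(x)-b_{\nu+1}(x)-1<C(\mathbf{L}_\nu(x))<\sqrt{(\nu+\tfrac12)^2+x^2}+2b_\nu(x)-\tfrac12,$$ where the lower bound holds for $\nu\ge-1$ and the upper bound holds for $\nu\ge-\frac12$; $$C(\mathbf{L}_\nu(x))>\nu+2b_\nu(x)+\frac{x^2}{\nu+\frac12+2b_{\nu+1}(x)+\sqrt{(\nu+\frac32)^2+x^2}},$$ which is valid for $\nu\ge-1$. -/

import Mathlib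

/-- The modified Bessel function of the first kind `I_ν(x)`, through its power series
`∑ (x/2)^(2n+ν) / (n! Γ(n+ν+1))`, for real order `ν` and real argument `x > 0`. -/
noncomputable def besselI (ν x : ℝ) : ℝ :=
  ∑' n : ℕ, (x / 2) ^ (2 * (n : ℝ) + ν) / ((Nat.factorial n : ℝ) * Real.Gamma ((n : ℝ) + ν + 1))

/-- The modified Struve function of the first kind `𝐋_ν(x)`, through its power series
`∑ (x/2)^(2n+ν+1) / (Γ(n+3/2) Γ(n+ν+3/2))`, for real order `ν` and real argument `x > 0`. -/
noncomputable def struveL (ν x : ℝ) : ℝ :=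
  ∑' n : ℕ, (x / 2) ^ (2 * (n : ℝ) + ν + 1) /
    (Real.Gamma ((n : ℝ) + 3 / 2) * Real.Gamma ((n : ℝ) + ν + 3 / 2))

/-- `a_ν(x) = (x/2)^ν / (√π Γ(ν+3/2))`. -/
noncomputable def struveA (ν x : ℝ) : ℝ :=
  (x / 2) ^ ν / (Real.sqrt Real.pi * Real.Gamma (ν + 3 / 2))

/-- `b_ν(x) = x a_ν(x) / (2 𝐋_ν(x))`. -/
noncomputable def struveB (ν x : ℝ) : ℝ :=
  x * struveA ν x / (2 * struveL ν x)

/-- The condition number `C(f(x)) = x f'(x) / f(x)`. -/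
noncomputable def condNumber (f : ℝ → ℝ) (x : ℝ) : ℝ :=
  x * deriv f x / f x

/-! Well-definedness: on `(0, ∞)` the two series converge, and their sums are positive and
differentiable, so no junk value enters the definitions above. -/

theorem gammaSeries_ratio_tendsto {p q : ℝ} (hp : 0 < p) (hq : 0 < q) :
    Filter.Tendsto (fun n : ℕ =>
      ‖(Real.Gamma (((n + 1 : ℕ) : ℝ) + p) * Real.Gamma (((n + 1 : ℕ) : ℝ) + q))⁻¹‖ /
      ‖(Real.Gamma ((n : ℝ) + p) * Real.Gamma ((n : ℝ) + q))⁻¹‖)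
      Filter.atTop (nhds 0) := by
  have key : ∀ n : ℕ,
      ‖(Real.Gamma (((n + 1 : ℕ) : ℝ) + p) * Real.Gamma (((n + 1 : ℕ) : ℝ) + q))⁻¹‖ /
      ‖(Real.Gamma ((n : ℝ) + p) * Real.Gamma ((n : ℝ) + q))⁻¹‖
      = ((n : ℝ) + p)⁻¹ * ((n : ℝ) + q)⁻¹ := by
    intro n
    have h1 : (0 : ℝ) < (n : ℝ) + p := by positivity
    have h2 : (0 : ℝ) < (n : ℝ) + q := by positivity
    have e1 : (((n + 1 : ℕ) : ℝ) + p) = ((n : ℝ) + p) + 1 := by push_cast; ring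
    have e2 : (((n + 1 : ℕ) : ℝ) + q) = ((n : ℝ) + q) + 1 := by push_cast; ring
    have g1 := Real.Gamma_pos_of_pos h1
    have g2 := Real.Gamma_pos_of_pos h2
    rw [e1, e2, Real.Gamma_add_one h1.ne', Real.Gamma_add_one h2.ne', Real.norm_of_nonneg (by positivity),
      Real.norm_of_nonneg (by positivity)]
    field_simp
  simp_rw [key]
  have t : ∀ r : ℝ, Filter.Tendsto (fun n : ℕ => ((n : ℝ) + r)⁻¹) Filter.atTop (nhds 0) :=
    fun r => Filter.Tendsto.inv_tendsto_atTop
      (Filter.tendsto_atTop_add_const_right _ r tendsto_natCast_atTop_atTop)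
  simpa using (t p).mul (t q)

theorem gammaSeries_ofScalars_radius {p q : ℝ} (hp : 0 < p) (hq : 0 < q) :
    (FormalMultilinearSeries.ofScalars ℝ
      (fun n : ℕ => (Real.Gamma ((n : ℝ) + p) * Real.Gamma ((n : ℝ) + q))⁻¹)).radius = ⊤ := by
  refine FormalMultilinearSeries.ofScalars_radius_eq_top_of_tendsto ℝ _ ?_
    (gammaSeries_ratio_tendsto hp hq)
  refine Filter.Eventually.of_forall fun n => ?_
  have g1 := Real.Gamma_pos_of_pos (show (0 : ℝ) < (n : ℝ) + p by positivity)
  have g2 := Real.Gamma_pos_of_pos (show (0 : ℝ) < (n : ℝ) + q by positivity)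
  positivity

theorem gammaSeries_hasSum {p q : ℝ} (hp : 0 < p) (hq : 0 < q) (y : ℝ) :
    HasSum (fun n : ℕ => (Real.Gamma ((n : ℝ) + p) * Real.Gamma ((n : ℝ) + q))⁻¹ * y ^ n)
      ((FormalMultilinearSeries.ofScalars ℝ
        (fun n : ℕ => (Real.Gamma ((n : ℝ) + p) * Real.Gamma ((n : ℝ) + q))⁻¹)).sum y) := by
  have h := (FormalMultilinearSeries.hasFPowerSeriesOnBall
    (FormalMultilinearSeries.ofScalars ℝ
      (fun n : ℕ => (Real.Gamma ((n : ℝ) + p) * Real.Gamma ((n : ℝ) + q))⁻¹))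
    (by rw [gammaSeries_ofScalars_radius hp hq]; simp)).hasSum (y := y)
    (by rw [gammaSeries_ofScalars_radius hp hq]; simp)
  simpa [FormalMultilinearSeries.ofScalars_apply_eq, smul_eq_mul, mul_comm (y ^ _)] using h

theorem gammaSeries_differentiable {p q : ℝ} (hp : 0 < p) (hq : 0 < q) :
    Differentiable ℝ (FormalMultilinearSeries.ofScalars ℝ
        (fun n : ℕ => (Real.Gamma ((n : ℝ) + p) * Real.Gamma ((n : ℝ) + q))⁻¹)).sum := by
  have h := (FormalMultilinearSeries.hasFPowerSeriesOnBall
    (FormalMultilinearSeries.ofScalars ℝ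
      (fun n : ℕ => (Real.Gamma ((n : ℝ) + p) * Real.Gamma ((n : ℝ) + q))⁻¹))
    (by rw [gammaSeries_ofScalars_radius hp hq]; simp)).differentiableOn
  rw [gammaSeries_ofScalars_radius hp hq] at h
  intro y
  exact (h y (by simp)).differentiableAt (by simp)

theorem half_rpow_term {x : ℝ} (hx : 0 < x) (n : ℕ) (s : ℝ) :
    (x / 2) ^ (2 * (n : ℝ) + s) = (x / 2) ^ s * ((x / 2) ^ 2) ^ n := by
  have h : 0 < x / 2 := by positivity
  rw [Real.rpow_add h, ← pow_mul, ← Real.rpow_natCast, mul_comm]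
  push_cast
  rfl

theorem besselI_hasSum {ν x : ℝ} (hν : -1 < ν) (hx : 0 < x) :
    HasSum (fun n : ℕ => (x / 2) ^ (2 * (n : ℝ) + ν) /
      ((Nat.factorial n : ℝ) * Real.Gamma ((n : ℝ) + ν + 1))) (besselI ν x) := by
  refine Summable.hasSum (((gammaSeries_hasSum (p := 1) (q := ν + 1) one_pos (by linarith)
    ((x / 2) ^ 2)).mul_left ((x / 2) ^ ν)).summable.congr fun n => ?_)
  rw [half_rpow_term hx, Real.Gamma_nat_eq_factorial, ← add_assoc]
  ring

theorem struveL_hasSum {ν x : ℝ} (hν : -(3 / 2) < ν) (hx : 0 < x) :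
    HasSum (fun n : ℕ => (x / 2) ^ (2 * (n : ℝ) + ν + 1) /
      (Real.Gamma ((n : ℝ) + 3 / 2) * Real.Gamma ((n : ℝ) + ν + 3 / 2))) (struveL ν x) := by
  refine Summable.hasSum (((gammaSeries_hasSum (p := 3 / 2) (q := ν + 3 / 2) (by norm_num)
    (by linarith) ((x / 2) ^ 2)).mul_left ((x / 2) ^ (ν + 1))).summable.congr fun n => ?_)
  rw [add_assoc (2 * (n : ℝ)), half_rpow_term hx, ← add_assoc]
  ring

theorem besselI_eq {ν x : ℝ} (hν : -1 < ν) (hx : 0 < x) :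
    besselI ν x = (x / 2) ^ ν * (FormalMultilinearSeries.ofScalars ℝ (fun n : ℕ =>
      (Real.Gamma ((n : ℝ) + 1) * Real.Gamma ((n : ℝ) + (ν + 1)))⁻¹)).sum ((x / 2) ^ 2) := by
  refine (besselI_hasSum hν hx).unique (((gammaSeries_hasSum (p := 1) (q := ν + 1) one_pos
    (by linarith) ((x / 2) ^ 2)).mul_left ((x / 2) ^ ν)).congr_fun fun n => ?_)
  rw [half_rpow_term hx, Real.Gamma_nat_eq_factorial, ← add_assoc]
  ring

theorem struveL_eq {ν x : ℝ} (hν : -(3 / 2) < ν) (hx : 0 < x) :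
    struveL ν x = (x / 2) ^ (ν + 1) * (FormalMultilinearSeries.ofScalars ℝ (fun n : ℕ =>
      (Real.Gamma ((n : ℝ) + 3 / 2) * Real.Gamma ((n : ℝ) + (ν + 3 / 2)))⁻¹)).sum
        ((x / 2) ^ 2) := by
  refine (struveL_hasSum hν hx).unique (((gammaSeries_hasSum (p := 3 / 2) (q := ν + 3 / 2)
    (by norm_num) (by linarith) ((x / 2) ^ 2)).mul_left ((x / 2) ^ (ν + 1))).congr_fun fun n => ?_)
  rw [add_assoc (2 * (n : ℝ)), half_rpow_term hx, ← add_assoc]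
  ring

theorem besselI_differentiableAt {ν x : ℝ} (hν : -1 < ν) (hx : 0 < x) :
    DifferentiableAt ℝ (besselI ν) x := by
  have hd := gammaSeries_differentiable (p := 1) (q := ν + 1) one_pos (by linarith)
  have h : DifferentiableAt ℝ (fun x : ℝ => (x / 2) ^ ν * (FormalMultilinearSeries.ofScalars ℝ
      (fun n : ℕ => (Real.Gamma ((n : ℝ) + 1) * Real.Gamma ((n : ℝ) + (ν + 1)))⁻¹)).sum
        ((x / 2) ^ 2)) x := by
    refine DifferentiableAt.mul ?_ ((hd _).comp x (by fun_prop))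
    exact DifferentiableAt.rpow_const (by fun_prop) (Or.inl (by positivity))
  refine h.congr_of_eventuallyEq ?_
  filter_upwards [lt_mem_nhds hx] with y hy using besselI_eq hν hy

theorem struveL_differentiableAt {ν x : ℝ} (hν : -(3 / 2) < ν) (hx : 0 < x) :
    DifferentiableAt ℝ (struveL ν) x := by
  have hd := gammaSeries_differentiable (p := 3 / 2) (q := ν + 3 / 2) (by norm_num) (by linarith)
  have h : DifferentiableAt ℝ (fun x : ℝ => (x / 2) ^ (ν + 1) *
      (FormalMultilinearSeries.ofScalars ℝ (fun n : ℕ =>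
        (Real.Gamma ((n : ℝ) + 3 / 2) * Real.Gamma ((n : ℝ) + (ν + 3 / 2)))⁻¹)).sum
        ((x / 2) ^ 2)) x := by
    refine DifferentiableAt.mul ?_ ((hd _).comp x (by fun_prop))
    exact DifferentiableAt.rpow_const (by fun_prop) (Or.inl (by positivity))
  refine h.congr_of_eventuallyEq ?_
  filter_upwards [lt_mem_nhds hx] with y hy using struveL_eq hν hy

theorem besselI_pos {ν x : ℝ} (hν : -1 < ν) (hx : 0 < x) : 0 < besselI ν x := by
  have hpos : ∀ n : ℕ, 0 < (x / 2) ^ (2 * (n : ℝ) + ν) /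
      ((Nat.factorial n : ℝ) * Real.Gamma ((n : ℝ) + ν + 1)) := fun n => by
    have g := Real.Gamma_pos_of_pos (show (0 : ℝ) < (n : ℝ) + ν + 1 by
      have : (0 : ℝ) ≤ n := n.cast_nonneg
      linarith)
    positivity
  exact (besselI_hasSum hν hx).summable.tsum_pos (fun n => (hpos n).le) 0 (hpos 0)

theorem struveL_pos {ν x : ℝ} (hν : -(3 / 2) < ν) (hx : 0 < x) : 0 < struveL ν x := by
  have hpos : ∀ n : ℕ, 0 < (x / 2) ^ (2 * (n : ℝ) + ν + 1) /
      (Real.Gamma ((n : ℝ) + 3 / 2) * Real.Gamma ((n : ℝ) + ν + 3 / 2)) := fun n => by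
    have g := Real.Gamma_pos_of_pos (show (0 : ℝ) < (n : ℝ) + ν + 3 / 2 by
      have : (0 : ℝ) ≤ n := n.cast_nonneg
      linarith)
    have g' := Real.Gamma_pos_of_pos (show (0 : ℝ) < (n : ℝ) + 3 / 2 by positivity)
    positivity
  exact (struveL_hasSum hν hx).summable.tsum_pos (fun n => (hpos n).le) 0 (hpos 0)

/-!
Both functions are normalised modified Lommel functions
`T_{p,q}(x) = ∑ (x/2)^(2n+p+q-2) / (Γ(n+p) Γ(n+q))`: `I_ν = T_{1,ν+1}` and
`𝐋_ν = T_{3/2,ν+3/2}`. The recurrence of the Gamma function, applied to each factor, gives the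
raising and lowering relations `mul_deriv_lommelT` and `mul_deriv_lommelT_succ`; they differ
between `I_ν` and `𝐋_ν` only by the term `x a_ν`. In particular
`C(𝐋_ν) = ν + 2 b_ν + x 𝐋_{ν+1} / 𝐋_ν` and `C(𝐋_{ν+1}) = x 𝐋_ν / 𝐋_{ν+1} - (ν + 1)`, and the same
for `I_ν` without `b_ν`, so every inequality is one about ratios of consecutive orders. Three facts
suffice.

* `struveL_succ_mul_besselI_lt`: `𝐋_{ν+1} / 𝐋_ν < I_{ν+1} / I_ν`, since `x` times the cross
  difference has derivative `x a_ν I_{ν+1} > 0` and is positive near `0`. At orders `ν` and `ν - 1`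
  this is the upper and the lower bound of `C(𝐋_ν)` by `C(I_ν)`.
* `besselI_ratio_lt`: the bound of `I_{ν+1} / I_ν` by the root of its Riccati equation, by the same
  method. Combined with the first fact it yields the bounds with square roots free of `b_ν` inside.
* `condNumber_struveL_lt_sqrt_add`: for fixed `x`, `C(𝐋_ν)` is the mean of the exponent
  `2n + ν + 1` under the weights given by the terms of the series. The second moment is computable
  from the recurrences, and nonnegativity of the variance is
  `C(𝐋_ν)² ≤ x² + ν² + 2 (2ν+1) b_ν`; with `C(𝐋_ν) > ν + 1` this is the bound with `b_ν` inside the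
  square root.

The two remaining lower bounds are these upper bounds at order `ν + 1`, transferred through the
ratio `𝐋_{ν+1} / 𝐋_ν` by `lt_condNumber_struveL_of_succ_lt`.
-/

/-! ### Termwise differentiation of everywhere convergent power series -/

theorem summable_mul_natCast_pow {c : ℕ → ℝ} (hc : ∀ y : ℝ, Summable fun n => c n * y ^ n)
    {R : ℝ} (hR : 1 ≤ R) : Summable fun n : ℕ => |c n| * (n * R ^ (n - 1)) := by
  refine Summable.of_nonneg_of_le (fun n => by positivity) (fun n => ?_) (hc (2 * R)).abs
  have h2 : (n : ℝ) ≤ 2 ^ n := by exact_mod_cast Nat.lt_two_pow_self.le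
  rw [abs_mul, abs_of_nonneg (show 0 ≤ (2 * R) ^ n by positivity), mul_pow]
  gcongr
  exact Nat.sub_le _ _

theorem hasDerivAt_tsum_mul_pow {c : ℕ → ℝ} (hc : ∀ y : ℝ, Summable fun n => c n * y ^ n)
    (y : ℝ) :
    HasDerivAt (fun z => ∑' n, c n * z ^ n) (∑' n, c n * (n * y ^ (n - 1))) y := by
  have hy : y ∈ Metric.ball (0 : ℝ) (|y| + 1) := by simp
  refine hasDerivAt_tsum_of_isPreconnected (t := Metric.ball 0 (|y| + 1))
    (g := fun n z => c n * z ^ n) (g' := fun n z => c n * (n * z ^ (n - 1)))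
    (summable_mul_natCast_pow hc (R := |y| + 1) (by simp)) Metric.isOpen_ball
    (convex_ball _ _).isPreconnected (fun n z _ => (hasDerivAt_pow n z).const_mul _)
    (fun n z hz => ?_) hy (hc y) hy
  have hz' : |z| ≤ |y| + 1 := by simpa using (Metric.mem_ball.1 hz).le
  rw [norm_mul, norm_mul, norm_pow, Real.norm_eq_abs, Real.norm_eq_abs, Real.norm_eq_abs,
    Nat.abs_cast]
  gcongr

theorem hasSum_natCast_mul_pow {c : ℕ → ℝ} (hc : ∀ y : ℝ, Summable fun n => c n * y ^ n)
    (y : ℝ) :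
    HasSum (fun n : ℕ => n * (c n * y ^ n)) (y * deriv (fun z => ∑' n, c n * z ^ n) y) := by
  have hs : Summable fun n : ℕ => c n * (n * y ^ (n - 1)) := by
    refine .of_norm_bounded (summable_mul_natCast_pow hc (R := |y| + 1) (by simp)) fun n => ?_
    rw [norm_mul, norm_mul, norm_pow, Real.norm_eq_abs, Real.norm_eq_abs, Real.norm_eq_abs,
      Nat.abs_cast]
    gcongr
    linarith
  rw [(hasDerivAt_tsum_mul_pow hc y).deriv]
  refine (hs.hasSum.mul_left y).congr_fun fun n => ?_
  cases n with
  | zero => simp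
  | succ n => simp only [Nat.add_sub_cancel]; ring

/-! ### Normalised modified Lommel functions -/

/-- The `n`-th term `(x/2)^(2n+p+q-2) / (Γ(n+p) Γ(n+q))` of the series `lommelT p q x`. -/
noncomputable def lommelTerm (p q x : ℝ) (n : ℕ) : ℝ :=
  (x / 2) ^ (2 * (n : ℝ) + (p + q - 2)) / (Real.Gamma (n + p) * Real.Gamma (n + q))

/-- The normalised modified Lommel function of the first kind, in the parametrisation in which the
series is symmetric in `p` and `q`. It contains both functions of interest:
`I_ν` is the case `(p, q) = (1, ν + 1)` and `𝐋_ν` the case `(p, q) = (3/2, ν + 3/2)`. -/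
noncomputable def lommelT (p q x : ℝ) : ℝ :=
  ∑' n : ℕ, lommelTerm p q x n

section Lommel

variable {p q x : ℝ}

theorem lommelTerm_pos (hp : 0 < p) (hq : 0 < q) (hx : 0 < x) (n : ℕ) :
    0 < lommelTerm p q x n := by
  have := Real.Gamma_pos_of_pos (show 0 < n + p by positivity)
  have := Real.Gamma_pos_of_pos (show 0 < n + q by positivity)
  unfold lommelTerm
  positivity

theorem lommelTerm_eq (hx : 0 < x) (n : ℕ) :
    lommelTerm p q x n = (x / 2) ^ (p + q - 2) *
      ((Real.Gamma (n + p) * Real.Gamma (n + q))⁻¹ * ((x / 2) ^ 2) ^ n) := by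
  rw [lommelTerm, half_rpow_term hx]
  ring

theorem hasSum_lommelTerm (hp : 0 < p) (hq : 0 < q) (hx : 0 < x) :
    HasSum (lommelTerm p q x) (lommelT p q x) := by
  refine Summable.hasSum (((gammaSeries_hasSum hp hq ((x / 2) ^ 2)).mul_left
    ((x / 2) ^ (p + q - 2))).summable.congr fun n => (lommelTerm_eq hx n).symm)

theorem lommelT_pos (hp : 0 < p) (hq : 0 < q) (hx : 0 < x) : 0 < lommelT p q x :=
  (hasSum_lommelTerm hp hq hx).summable.tsum_pos (fun n => (lommelTerm_pos hp hq hx n).le) 0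
    (lommelTerm_pos hp hq hx 0)

theorem lommelT_differentiableAt_and_hasSum (hp : 0 < p) (hq : 0 < q) (hx : 0 < x) :
    DifferentiableAt ℝ (lommelT p q) x ∧
      HasSum (fun n : ℕ => (2 * (n : ℝ) + (p + q - 2)) * lommelTerm p q x n)
        (x * deriv (lommelT p q) x) := by
  set c : ℕ → ℝ := fun n => (Real.Gamma (n + p) * Real.Gamma (n + q))⁻¹ with hcdef
  have hc : ∀ y : ℝ, Summable fun n => c n * y ^ n := fun y => (gammaSeries_hasSum hp hq y).summable
  set G : ℝ → ℝ := fun z => ∑' n, c n * z ^ n with hG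
  have heq : ∀ z : ℝ, 0 < z → lommelT p q z = (z / 2) ^ (p + q - 2) * G ((z / 2) ^ 2) := by
    intro z hz
    rw [lommelT, hG, ← tsum_mul_left]
    exact tsum_congr fun n => lommelTerm_eq hz n
  have hGd : HasDerivAt G (deriv G ((x / 2) ^ 2)) ((x / 2) ^ 2) :=
    (hasDerivAt_tsum_mul_pow hc _).differentiableAt.hasDerivAt
  have hx2 : x / 2 ≠ 0 := by positivity
  have hhalf : HasDerivAt (fun z : ℝ => z / 2) (1 / 2) x := (hasDerivAt_id x).div_const 2
  have hd : HasDerivAt (lommelT p q)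
      (1 / 2 * (p + q - 2) * (x / 2) ^ (p + q - 2 - 1) * G ((x / 2) ^ 2) +
        (x / 2) ^ (p + q - 2) * (deriv G ((x / 2) ^ 2) * (2 * (x / 2) ^ (2 - 1) * (1 / 2)))) x := by
    have h := (hhalf.rpow_const (p := p + q - 2) (Or.inl hx2)).mul
      (hGd.comp x (hhalf.pow 2))
    refine HasDerivAt.congr_of_eventuallyEq (by simpa using h) ?_
    filter_upwards [lt_mem_nhds hx] with z hz using heq z hz
  refine ⟨hd.differentiableAt, ?_⟩
  have h1 := (((hasSum_natCast_mul_pow hc ((x / 2) ^ 2)).mul_left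
    (2 * (x / 2) ^ (p + q - 2)))).add ((hasSum_lommelTerm hp hq hx).mul_left (p + q - 2))
  convert! h1 using 1
  · funext n
    rw [lommelTerm_eq hx]
    ring
  · rw [hd.deriv, heq x hx, Real.rpow_sub_one hx2]
    field_simp
    ring

theorem lommelTerm_succ_right (hq : 0 < q) (hx : 0 < x) (n : ℕ) :
    (n + q) * lommelTerm p (q + 1) x n = x / 2 * lommelTerm p q x n := by
  have hx2 : x / 2 ≠ 0 := by positivity
  have hnq : (n : ℝ) + q ≠ 0 := by positivity
  rw [lommelTerm, lommelTerm, ← add_assoc (n : ℝ), Real.Gamma_add_one hnq,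
    show 2 * (n : ℝ) + (p + (q + 1) - 2) = 2 * n + (p + q - 2) + 1 by ring,
    Real.rpow_add_one hx2]
  field_simp

theorem lommelTerm_succ_index (hp : 0 < p) (hq : 0 < q) (hx : 0 < x) (n : ℕ) :
    (n + p) * lommelTerm p q x (n + 1) = x / 2 * lommelTerm p (q + 1) x n := by
  have hx2 : x / 2 ≠ 0 := by positivity
  have hnp : (n : ℝ) + p ≠ 0 := by positivity
  have hnq : (n : ℝ) + q ≠ 0 := by positivity
  rw [lommelTerm, lommelTerm, Nat.cast_add_one, show (n : ℝ) + 1 + p = n + p + 1 by ring,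
    show (n : ℝ) + 1 + q = n + q + 1 by ring, Real.Gamma_add_one hnp,
    ← add_assoc (n : ℝ), show 2 * ((n : ℝ) + 1) + (p + q - 2) = 2 * n + (p + (q + 1) - 2) + 1 by ring,
    Real.rpow_add_one hx2]
  field_simp

/-- The inhomogeneity `2 (p - 1) (x/2)^(p+q-2) / (Γ(p) Γ(q))` that separates the recurrences of
`lommelT p q` from those of the modified Bessel function: it vanishes for `p = 1`, and for
`p = 3/2`, `q = ν + 3/2` it is `x a_ν(x)`. -/
noncomputable def lommelDefect (p q x : ℝ) : ℝ :=
  2 * (p - 1) * lommelTerm p q x 0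

/-- Lowering relation `x T_{p,q+1}' = x T_{p,q} - (q - p + 1) T_{p,q+1}`. -/
theorem mul_deriv_lommelT_succ (hp : 0 < p) (hq : 0 < q) (hx : 0 < x) :
    x * deriv (lommelT p (q + 1)) x =
      x * lommelT p q x - (q - p + 1) * lommelT p (q + 1) x := by
  refine (lommelT_differentiableAt_and_hasSum hp (by linarith) hx).2.unique ?_
  refine (((hasSum_lommelTerm hp hq hx).mul_left x).sub
    ((hasSum_lommelTerm hp (by linarith : 0 < q + 1) hx).mul_left (q - p + 1))).congr_fun fun n => ?_
  linear_combination 2 * lommelTerm_succ_right (p := p) hq hx n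

/-- Raising relation: `x T_{p,q}' = (q - p) T_{p,q} + x T_{p,q+1}` up to `lommelDefect`, which is
the contribution of the index `0`. -/
theorem mul_deriv_lommelT (hp : 0 < p) (hq : 0 < q) (hx : 0 < x) :
    x * deriv (lommelT p q) x =
      (q - p) * lommelT p q x + x * lommelT p (q + 1) x + lommelDefect p q x := by
  have h1 : HasSum (fun n : ℕ => 2 * ((n : ℝ) + (p - 1)) * lommelTerm p q x n)
      (x * deriv (lommelT p q) x - (q - p) * lommelT p q x) :=
    ((lommelT_differentiableAt_and_hasSum hp hq hx).2.sub
      ((hasSum_lommelTerm hp hq hx).mul_left (q - p))).congr_fun fun n => by ring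
  have h2 := ((hasSum_lommelTerm hp (by linarith : 0 < q + 1) hx).mul_left x).congr_fun
    (g := fun n : ℕ => 2 * (((n + 1 : ℕ) : ℝ) + (p - 1)) * lommelTerm p q x (n + 1)) fun n => by
      push_cast
      linear_combination 2 * lommelTerm_succ_index hp hq hx n
  have h3 := ((hasSum_nat_add_iff' 1).2 h1).unique h2
  simp only [Finset.sum_range_one, Nat.cast_zero, zero_add] at h3
  rw [lommelDefect]
  linarith

/-- Three-term recurrence `x T_{p,q} = 2 (q - p + 1) T_{p,q+1} + x T_{p,q+2}` up to the defect. -/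
theorem lommelT_three_term (hp : 0 < p) (hq : 0 < q) (hx : 0 < x) :
    x * lommelT p q x = 2 * (q - p + 1) * lommelT p (q + 1) x + x * lommelT p (q + 2) x +
      lommelDefect p (q + 1) x := by
  have h1 := mul_deriv_lommelT_succ hp hq hx
  have h2 := mul_deriv_lommelT hp (by linarith : 0 < q + 1) hx
  rw [add_assoc q, one_add_one_eq_two] at h2
  linarith

theorem lommelT_succ_le (hp : 0 < p) (hq : 0 < q) (hx : 0 < x) :
    2 * q * lommelT p (q + 1) x ≤ x * lommelT p q x := by
  refine hasSum_le (fun n => ?_) ((hasSum_lommelTerm hp (by linarith) hx).mul_left (2 * q))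
    ((hasSum_lommelTerm hp hq hx).mul_left x)
  have := lommelTerm_succ_right (p := p) hq hx n
  have : 0 ≤ (n : ℝ) * lommelTerm p (q + 1) x n :=
    mul_nonneg n.cast_nonneg (lommelTerm_pos hp (by linarith) hx n).le
  linarith

/-- The condition number of a Lommel function is the mean of `2 n + p + q - 2` under the weights
given by the terms, so it exceeds the value at `n = 0`. -/
theorem lt_condNumber_lommelT (hp : 0 < p) (hq : 0 < q) (hx : 0 < x) :
    p + q - 2 < condNumber (lommelT p q) x := by
  rw [condNumber, lt_div_iff₀ (lommelT_pos hp hq hx)]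
  refine hasSum_lt (i := 1) (fun n => ?_) ?_
    ((hasSum_lommelTerm hp hq hx).mul_left (p + q - 2)) (lommelT_differentiableAt_and_hasSum hp hq hx).2
  · have := lommelTerm_pos hp hq hx n
    refine mul_le_mul_of_nonneg_right ?_ this.le
    have : (0 : ℝ) ≤ n := n.cast_nonneg
    linarith
  · refine mul_lt_mul_of_pos_right ?_ (lommelTerm_pos hp hq hx 1)
    norm_num

/-- The variance of `2 n + p + q - 2` under the weights given by the terms is nonnegative; its
second moment is computed by the two Gamma recurrences. This says that the condition number is
nondecreasing in `x`. -/
theorem condNumber_lommelT_sq_le (hp : 0 < p) (hq : 0 < q) (hx : 0 < x) :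
    condNumber (lommelT p q) x ^ 2 ≤
      x ^ 2 + (q - p) ^ 2 + 2 * (q - 1) * lommelDefect p q x / lommelT p q x := by
  have hT := lommelT_pos hp hq hx
  have hs := hasSum_lommelTerm hp hq hx
  have hd := (lommelT_differentiableAt_and_hasSum hp hq hx).2
  set C := condNumber (lommelT p q) x with hC
  have hCT : x * deriv (lommelT p q) x = C * lommelT p q x := by
    rw [hC, condNumber]
    field_simp
  rw [hCT] at hd
  have h1 : HasSum (fun n : ℕ => ((2 * (n : ℝ) + (p + q - 2)) ^ 2 - (q - p) ^ 2) *
      lommelTerm p q x n)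
      (x ^ 2 * lommelT p q x + 4 * (p - 1) * (q - 1) * lommelTerm p q x 0) := by
    refine (hasSum_nat_add_iff' 1).1 ?_
    convert! (hs.mul_left (x ^ 2)).congr_fun (fun n => ?_) using 1
    · simp only [Finset.sum_range_one, Nat.cast_zero]
      ring
    · have e1 := lommelTerm_succ_right (p := p) hq hx n
      have e2 := lommelTerm_succ_index hp hq hx n
      push_cast
      linear_combination 2 * x * e1 + 4 * ((n : ℝ) + q) * e2
  have h2 := (h1.add (hs.mul_left ((q - p) ^ 2 + C ^ 2))).sub (hd.mul_left (2 * C))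
  have h3 := h2.nonneg fun n => by
    have := lommelTerm_pos hp hq hx n
    have e : ((2 * (n : ℝ) + (p + q - 2)) ^ 2 - (q - p) ^ 2) * lommelTerm p q x n +
        ((q - p) ^ 2 + C ^ 2) * lommelTerm p q x n -
        2 * C * ((2 * (n : ℝ) + (p + q - 2)) * lommelTerm p q x n) =
        (2 * (n : ℝ) + (p + q - 2) - C) ^ 2 * lommelTerm p q x n := by ring
    rw [e]
    positivity
  rw [← sub_le_iff_le_add', le_div_iff₀ hT, lommelDefect]
  linarith

end Lommel

/-! ### Modified Bessel and Struve functions as Lommel functions -/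

theorem besselI_eq_lommelT (ν : ℝ) : besselI ν = lommelT 1 (ν + 1) := by
  funext x
  refine tsum_congr fun n => ?_
  rw [lommelTerm, Real.Gamma_nat_eq_factorial]
  ring_nf

theorem struveL_eq_lommelT (ν : ℝ) : struveL ν = lommelT (3 / 2) (ν + 3 / 2) := by
  funext x
  refine tsum_congr fun n => ?_
  rw [lommelTerm]
  ring_nf

theorem struveL_succ_eq_lommelT (ν : ℝ) :
    struveL (ν + 1) = lommelT (3 / 2) (ν + 3 / 2 + 1) := by
  rw [struveL_eq_lommelT, add_right_comm]

section BesselStruve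

variable {ν x : ℝ}

theorem lommelDefect_one (q x : ℝ) : lommelDefect 1 q x = 0 := by
  simp [lommelDefect]

theorem lommelDefect_struve (hx : 0 < x) :
    lommelDefect (3 / 2) (ν + 3 / 2) x = x * struveA ν x := by
  have hx2 : x / 2 ≠ 0 := by positivity
  have hG : Real.Gamma (3 / 2) = Real.sqrt Real.pi / 2 := by
    rw [show (3 / 2 : ℝ) = 1 / 2 + 1 by norm_num, Real.Gamma_add_one (by norm_num),
      Real.Gamma_one_half_eq]
    ring
  have hpi : Real.sqrt Real.pi ≠ 0 := (Real.sqrt_pos.2 Real.pi_pos).ne'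
  rw [lommelDefect, lommelTerm, struveA, Nat.cast_zero, zero_add, zero_add, hG,
    show 2 * (0 : ℝ) + (3 / 2 + (ν + 3 / 2) - 2) = ν + 1 by ring, Real.rpow_add_one hx2]
  field_simp
  ring

theorem struveA_pos (hν : -(3 / 2) < ν) (hx : 0 < x) : 0 < struveA ν x := by
  have := Real.Gamma_pos_of_pos (show 0 < ν + 3 / 2 by linarith)
  unfold struveA
  positivity

theorem struveB_pos (hν : -(3 / 2) < ν) (hx : 0 < x) : 0 < struveB ν x := by
  have := struveA_pos hν hx
  have := struveL_pos hν hx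
  unfold struveB
  positivity

theorem mul_deriv_besselI (hν : -1 < ν) (hx : 0 < x) :
    x * deriv (besselI ν) x = ν * besselI ν x + x * besselI (ν + 1) x := by
  have h := mul_deriv_lommelT (p := 1) (q := ν + 1) one_pos (by linarith) hx
  rw [← besselI_eq_lommelT, ← besselI_eq_lommelT, lommelDefect_one] at h
  linarith

theorem mul_deriv_besselI_succ (hν : -1 < ν) (hx : 0 < x) :
    x * deriv (besselI (ν + 1)) x = x * besselI ν x - (ν + 1) * besselI (ν + 1) x := by
  have h := mul_deriv_lommelT_succ (p := 1) (q := ν + 1) one_pos (by linarith) hx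
  rw [← besselI_eq_lommelT, ← besselI_eq_lommelT] at h
  linarith

theorem mul_deriv_struveL (hν : -(3 / 2) < ν) (hx : 0 < x) :
    x * deriv (struveL ν) x =
      ν * struveL ν x + x * struveL (ν + 1) x + x * struveA ν x := by
  have h := mul_deriv_lommelT (p := 3 / 2) (q := ν + 3 / 2) (by norm_num) (by linarith) hx
  rw [← struveL_eq_lommelT, ← struveL_succ_eq_lommelT, lommelDefect_struve hx] at h
  linarith

theorem mul_deriv_struveL_succ (hν : -(3 / 2) < ν) (hx : 0 < x) :
    x * deriv (struveL (ν + 1)) x = x * struveL ν x - (ν + 1) * struveL (ν + 1) x := by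
  have h := mul_deriv_lommelT_succ (p := 3 / 2) (q := ν + 3 / 2) (by norm_num) (by linarith) hx
  rw [← struveL_eq_lommelT, ← struveL_succ_eq_lommelT] at h
  linarith

theorem condNumber_besselI (hν : -1 < ν) (hx : 0 < x) :
    condNumber (besselI ν) x = ν + x * besselI (ν + 1) x / besselI ν x := by
  have := besselI_pos hν hx
  rw [condNumber, mul_deriv_besselI hν hx]
  field_simp

theorem condNumber_besselI_succ (hν : -1 < ν) (hx : 0 < x) :
    condNumber (besselI (ν + 1)) x = x * besselI ν x / besselI (ν + 1) x - (ν + 1) := by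
  have := besselI_pos (show -1 < ν + 1 by linarith) hx
  rw [condNumber, mul_deriv_besselI_succ hν hx]
  field_simp

theorem condNumber_struveL (hν : -(3 / 2) < ν) (hx : 0 < x) :
    condNumber (struveL ν) x =
      ν + 2 * struveB ν x + x * struveL (ν + 1) x / struveL ν x := by
  have := struveL_pos hν hx
  rw [condNumber, mul_deriv_struveL hν hx, struveB]
  field_simp
  ring

theorem condNumber_struveL_succ (hν : -(3 / 2) < ν) (hx : 0 < x) :
    condNumber (struveL (ν + 1)) x = x * struveL ν x / struveL (ν + 1) x - (ν + 1) := by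
  have := struveL_pos (show -(3 / 2) < ν + 1 by linarith) hx
  rw [condNumber, mul_deriv_struveL_succ hν hx]
  field_simp

/-! ### Comparison of ratios -/

theorem pos_of_hasDerivAt_nonneg {f f' : ℝ → ℝ} (hd : ∀ y, 0 < y → HasDerivAt f (f' y) y)
    (hf' : ∀ y, 0 < y → 0 ≤ f' y) (h0 : ∀ y, 0 < y → y < 1 → 0 < f y) (hx : 0 < x) :
    0 < f x := by
  have hmono : MonotoneOn f (Set.Ioi 0) := by
    refine monotoneOn_of_deriv_nonneg (convex_Ioi 0)
      (fun y hy => (hd y hy).continuousAt.continuousWithinAt) ?_ ?_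
    · rw [interior_Ioi]
      exact fun y hy => (hd y hy).differentiableAt.differentiableWithinAt
    · rw [interior_Ioi]
      intro y hy
      rw [(hd y hy).deriv]
      exact hf' y hy
  have hm : 0 < min x (1 / 2) := by positivity
  exact (h0 _ hm ((min_le_right _ _).trans_lt (by norm_num))).trans_le
    (hmono hm hx (min_le_left _ _))

theorem mul_besselI_succ_le (hν : -1 < ν) (hx : 0 < x) :
    2 * (ν + 1) * besselI (ν + 1) x ≤ x * besselI ν x := by
  rw [besselI_eq_lommelT, besselI_eq_lommelT]
  exact lommelT_succ_le one_pos (by linarith) hx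

theorem mul_struveL_succ_le (hν : -(3 / 2) < ν) (hx : 0 < x) :
    2 * (ν + 3 / 2) * struveL (ν + 1) x ≤ x * struveL ν x := by
  rw [struveL_succ_eq_lommelT, struveL_eq_lommelT]
  exact lommelT_succ_le (by norm_num) (by linarith) hx

theorem besselI_three_term (hν : -1 < ν) (hx : 0 < x) :
    x * besselI ν x = 2 * (ν + 1) * besselI (ν + 1) x + x * besselI (ν + 1 + 1) x := by
  have h := lommelT_three_term (p := 1) (q := ν + 1) one_pos (by linarith) hx
  rw [lommelDefect_one, ← one_add_one_eq_two, ← add_assoc (ν + 1), ← besselI_eq_lommelT,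
    ← besselI_eq_lommelT, ← besselI_eq_lommelT] at h
  linarith

/-- The Wronskian-type expression `x (𝐋_ν I_{ν+1} - 𝐋_{ν+1} I_ν)` has derivative
`x a_ν I_{ν+1} > 0`, and it is positive near `0`; so the ratio `𝐋_{ν+1} / 𝐋_ν` is smaller than
`I_{ν+1} / I_ν`. -/
theorem struveL_succ_mul_besselI_lt (hν : -1 < ν) (hx : 0 < x) :
    struveL (ν + 1) x * besselI ν x < struveL ν x * besselI (ν + 1) x := by
  have hν' : -(3 / 2) < ν := by linarith
  have hν1 : -1 < ν + 1 := by linarith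
  have key : 0 < x * (struveL ν x * besselI (ν + 1) x - struveL (ν + 1) x * besselI ν x) := by
    refine pos_of_hasDerivAt_nonneg
      (f := fun y => y * (struveL ν y * besselI (ν + 1) y - struveL (ν + 1) y * besselI ν y))
      (f' := fun y => y * struveA ν y * besselI (ν + 1) y) (fun y hy => ?_) (fun y hy => ?_)
      (fun y hy hy1 => ?_) hx
    · have hL := (struveL_differentiableAt hν' hy).hasDerivAt
      have hL1 := (struveL_differentiableAt (show -(3 / 2) < ν + 1 by linarith) hy).hasDerivAt
      have hI := (besselI_differentiableAt hν hy).hasDerivAt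
      have hI1 := (besselI_differentiableAt hν1 hy).hasDerivAt
      convert! (hasDerivAt_id y).mul ((hL.mul hI1).sub (hL1.mul hI)) using 1
      simp only [id, Pi.mul_apply, Pi.sub_apply]
      linear_combination (-besselI (ν + 1) y) * mul_deriv_struveL hν' hy
        - struveL ν y * mul_deriv_besselI_succ hν hy
        + besselI ν y * mul_deriv_struveL_succ hν' hy
        + struveL (ν + 1) y * mul_deriv_besselI hν hy
    · have := struveA_pos hν' hy
      have := besselI_pos hν1 hy
      positivity
    · have hL := struveL_pos hν' hy
      have hI := besselI_pos hν hy
      have hI1 := besselI_pos hν1 hy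
      have h1 := mul_struveL_succ_le hν' hy
      have h2 := besselI_three_term hν hy
      have h3 := mul_besselI_succ_le hν1 hy
      -- `y I_{ν+2} < I_{ν+1}`, since `2 (ν + 2) > 1 > y ^ 2`
      have h4 : y * besselI (ν + 1 + 1) y < besselI (ν + 1) y := by
        have hI2 := besselI_pos (show -1 < ν + 1 + 1 by linarith) hy
        nlinarith [mul_le_mul_of_nonneg_left h3 hy.le, mul_pos hy hI2, mul_pos hy hI1]
      have h5 : y * besselI ν y < 2 * (ν + 3 / 2) * besselI (ν + 1) y := by linarith
      have h6 := mul_le_mul_of_nonneg_right h1 hI.le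
      have h7 := mul_lt_mul_of_pos_left h5 hL
      have h8 : 0 < 2 * (ν + 3 / 2) := by linarith
      refine mul_pos hy (sub_pos.2 (lt_of_mul_lt_mul_left ?_ h8.le))
      linarith
  have := pos_of_mul_pos_right key hx.le
  linarith

/-- The expression `x (I_ν² - I_{ν+1}²) - (2ν+1) I_ν I_{ν+1}` has derivative
`(2ν+1) I_ν I_{ν+1} / x ≥ 0`, and it is positive near `0`. This is the statement that
`I_{ν+1} / I_ν` increases, read off its Riccati equation. -/
theorem besselI_riccati_pos (hν : -(1 / 2) ≤ ν) (hx : 0 < x) :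
    0 < x * (besselI ν x ^ 2 - besselI (ν + 1) x ^ 2) -
      (2 * ν + 1) * (besselI ν x * besselI (ν + 1) x) := by
  have hν' : -1 < ν := by linarith
  have hν1 : -1 < ν + 1 := by linarith
  refine pos_of_hasDerivAt_nonneg
    (f := fun y => y * (besselI ν y ^ 2 - besselI (ν + 1) y ^ 2) -
      (2 * ν + 1) * (besselI ν y * besselI (ν + 1) y))
    (f' := fun y => (2 * ν + 1) * (besselI ν y * besselI (ν + 1) y) / y)
    (fun y hy => ?_) (fun y hy => ?_) (fun y hy hy1 => ?_) hx
  · have hI := (besselI_differentiableAt hν' hy).hasDerivAt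
    have hI1 := (besselI_differentiableAt hν1 hy).hasDerivAt
    convert! ((hasDerivAt_id y).mul ((hI.pow 2).sub (hI1.pow 2))).sub
      ((hI.mul hI1).const_mul (2 * ν + 1)) using 1
    simp only [id, Pi.pow_apply, Pi.sub_apply]
    rw [div_eq_iff hy.ne']
    norm_num
    have e1 := mul_deriv_besselI hν' hy
    have e2 := mul_deriv_besselI_succ hν' hy
    linear_combination
      (-2 * y * besselI ν y + (2 * ν + 1) * besselI (ν + 1) y) * e1 +
      (2 * y * besselI (ν + 1) y + (2 * ν + 1) * besselI ν y) * e2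
  · have := besselI_pos hν' hy
    have := besselI_pos hν1 hy
    have : 0 ≤ 2 * ν + 1 := by linarith
    positivity
  · have hI := besselI_pos hν' hy
    have hI1 := besselI_pos hν1 hy
    have h := mul_besselI_succ_le hν' hy
    -- with `v / u ≤ y / k`, `k = 2 (ν + 1) ≥ 1`, the expression is at least `y u² (1/k - y²/k²)`
    obtain ⟨r, hr⟩ : ∃ r, r = besselI (ν + 1) y / besselI ν y := ⟨_, rfl⟩
    have hv : besselI (ν + 1) y = r * besselI ν y := by rw [hr]; field_simp
    have hr0 : 0 < r := by rw [hr]; positivity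
    rw [hv, ← mul_assoc] at h
    have h' : 2 * (ν + 1) * r ≤ y := le_of_mul_le_mul_right h hI
    have hk : 1 ≤ 2 * (ν + 1) := by linarith
    have hry : r ≤ y := by nlinarith
    have hb : 0 < y * (1 - r ^ 2) - (2 * ν + 1) * r := by nlinarith
    have e : y * (besselI ν y ^ 2 - besselI (ν + 1) y ^ 2) -
        (2 * ν + 1) * (besselI ν y * besselI (ν + 1) y) =
        besselI ν y ^ 2 * (y * (1 - r ^ 2) - (2 * ν + 1) * r) := by rw [hv]; ring
    simp only [e]
    positivity

/-- An upper bound for `I_{ν+1} / I_ν`: the positive root of the quadratic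
`t² + (2ν+1) t - x²`. -/
theorem besselI_ratio_lt (hν : -(1 / 2) ≤ ν) (hx : 0 < x) :
    x * besselI (ν + 1) x / besselI ν x <
      Real.sqrt ((ν + 1 / 2) ^ 2 + x ^ 2) - (ν + 1 / 2) := by
  have hI := besselI_pos (show -1 < ν by linarith) hx
  rw [lt_sub_iff_add_lt]
  refine Real.lt_sqrt_of_sq_lt ?_
  have h := mul_pos hx (besselI_riccati_pos hν hx)
  have e : (ν + 1 / 2) ^ 2 + x ^ 2 -
      (x * besselI (ν + 1) x / besselI ν x + (ν + 1 / 2)) ^ 2 =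
      x * (x * (besselI ν x ^ 2 - besselI (ν + 1) x ^ 2) -
      (2 * ν + 1) * (besselI ν x * besselI (ν + 1) x)) / besselI ν x ^ 2 := by
    field_simp
    ring
  have := div_pos h (pow_pos hI 2)
  linarith

theorem struveL_ratio_lt_besselI_ratio (hν : -1 < ν) (hx : 0 < x) :
    x * struveL (ν + 1) x / struveL ν x < x * besselI (ν + 1) x / besselI ν x := by
  have hL := struveL_pos (show -(3 / 2) < ν by linarith) hx
  rw [div_lt_div_iff₀ hL (besselI_pos hν hx)]
  have := mul_lt_mul_of_pos_left (struveL_succ_mul_besselI_lt hν hx) hx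
  linarith

/-! ### Bounds for the condition number of the modified Struve function -/

theorem condNumber_besselI_lt (hν : -(1 / 2) ≤ ν) (hx : 0 < x) :
    condNumber (besselI ν) x < Real.sqrt ((ν + 1 / 2) ^ 2 + x ^ 2) - 1 / 2 := by
  rw [condNumber_besselI (by linarith) hx]
  linarith [besselI_ratio_lt hν hx]

theorem lt_condNumber_besselI (hν : 1 / 2 ≤ ν) (hx : 0 < x) :
    Real.sqrt ((ν - 1 / 2) ^ 2 + x ^ 2) - 1 / 2 < condNumber (besselI ν) x := by
  obtain ⟨μ, rfl⟩ : ∃ μ, ν = μ + 1 := ⟨ν - 1, by ring⟩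
  have hμ : -(1 / 2) ≤ μ := by linarith
  have hI := besselI_pos (show -1 < μ by linarith) hx
  have hI1 := besselI_pos (show -1 < μ + 1 by linarith) hx
  have h := besselI_ratio_lt hμ hx
  rw [condNumber_besselI_succ (by linarith) hx, show μ + 1 - 1 / 2 = μ + 1 / 2 by ring]
  have hs := Real.sq_sqrt (show 0 ≤ (μ + 1 / 2) ^ 2 + x ^ 2 by positivity)
  have hs0 := Real.sqrt_nonneg ((μ + 1 / 2) ^ 2 + x ^ 2)
  set s := Real.sqrt ((μ + 1 / 2) ^ 2 + x ^ 2)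
  have hsx : 0 < s + (μ + 1 / 2) := by
    have : 0 < x * besselI (μ + 1) x / besselI μ x := by positivity
    linarith
  -- `s + (μ + 1/2)` is `x ^ 2 / (s - (μ + 1/2))`
  have : s + (μ + 1 / 2) < x * besselI μ x / besselI (μ + 1) x := by
    rw [lt_div_iff₀ hI1]
    rw [div_lt_iff₀ hI] at h
    have h' := mul_lt_mul_of_pos_right h hsx
    have e : (s - (μ + 1 / 2)) * besselI μ x * (s + (μ + 1 / 2)) = x * (x * besselI μ x) := by
      linear_combination besselI μ x * hs
    rw [e] at h'
    refine lt_of_mul_lt_mul_left ?_ hx.le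
    linarith
  linarith

theorem condNumber_besselI_lt_condNumber_struveL (hν : 0 < ν) (hx : 0 < x) :
    condNumber (besselI ν) x < condNumber (struveL ν) x := by
  obtain ⟨μ, rfl⟩ : ∃ μ, ν = μ + 1 := ⟨ν - 1, by ring⟩
  have hμ : -1 < μ := by linarith
  have hI1 := besselI_pos (show -1 < μ + 1 by linarith) hx
  have hL1 := struveL_pos (show -(3 / 2) < μ + 1 by linarith) hx
  rw [condNumber_besselI_succ hμ hx, condNumber_struveL_succ (by linarith) hx,
    sub_lt_sub_iff_right, div_lt_div_iff₀ hI1 hL1]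
  have := mul_lt_mul_of_pos_left (struveL_succ_mul_besselI_lt hμ hx) hx
  linarith

theorem condNumber_struveL_lt_condNumber_besselI_add (hν : -1 < ν) (hx : 0 < x) :
    condNumber (struveL ν) x < condNumber (besselI ν) x + 2 * struveB ν x := by
  rw [condNumber_besselI hν hx, condNumber_struveL (by linarith) hx]
  linarith [struveL_ratio_lt_besselI_ratio hν hx]

theorem condNumber_struveL_lt_sqrt_add_two_mul (hν : -(1 / 2) ≤ ν) (hx : 0 < x) :
    condNumber (struveL ν) x <
      Real.sqrt ((ν + 1 / 2) ^ 2 + x ^ 2) + 2 * struveB ν x - 1 / 2 := by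
  linarith [condNumber_besselI_lt hν hx,
    condNumber_struveL_lt_condNumber_besselI_add (show -1 < ν by linarith) hx]

/-- Writing `C` for the condition number, `condNumber_lommelT_sq_le` reads
`C² ≤ x² + ν² + 2 (2ν+1) b_ν`, and together with `C > ν + 1` this gives
`(C - b_ν)² < (ν + b_ν)² + x²`. -/
theorem condNumber_struveL_lt_sqrt_add (hν : -(3 / 2) < ν) (hx : 0 < x) :
    condNumber (struveL ν) x <
      Real.sqrt ((ν + struveB ν x) ^ 2 + x ^ 2) + struveB ν x := by
  have hL := struveL_pos hν hx
  have hb := struveB_pos hν hx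
  have hq : 0 < ν + 3 / 2 := by linarith
  have h1 := lt_condNumber_lommelT (p := 3 / 2) (by norm_num) hq hx
  have h2 := condNumber_lommelT_sq_le (p := 3 / 2) (by norm_num) hq hx
  rw [lommelDefect_struve hx, ← struveL_eq_lommelT] at h2
  rw [← struveL_eq_lommelT] at h1
  have e : 2 * (ν + 3 / 2 - 1) * (x * struveA ν x) / struveL ν x =
      2 * (2 * ν + 1) * struveB ν x := by
    rw [struveB]
    field_simp
    ring
  rw [e] at h2
  rw [← sub_lt_iff_lt_add]
  refine Real.lt_sqrt_of_sq_lt ?_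
  have := mul_pos hb (show 0 < condNumber (struveL ν) x - (ν + 1) by linarith)
  nlinarith

/-- An upper bound for `C(𝐋_{ν+1})` bounds `x 𝐋_ν / 𝐋_{ν+1}` from above, hence
`x 𝐋_{ν+1} / 𝐋_ν`, and with it `C(𝐋_ν)`, from below. -/
theorem lt_condNumber_struveL_of_succ_lt {M : ℝ} (hν : -(3 / 2) < ν) (hx : 0 < x)
    (hM : condNumber (struveL (ν + 1)) x < M) :
    ν + 2 * struveB ν x + x ^ 2 / (M + (ν + 1)) < condNumber (struveL ν) x := by
  have hL := struveL_pos hν hx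
  have hL1 := struveL_pos (show -(3 / 2) < ν + 1 by linarith) hx
  rw [condNumber_struveL_succ hν hx, sub_lt_iff_lt_add] at hM
  have h0 : 0 < x * struveL ν x / struveL (ν + 1) x := by positivity
  have h := div_lt_div_of_pos_left (pow_pos hx 2) h0 hM
  have e : x ^ 2 / (x * struveL ν x / struveL (ν + 1) x) =
      x * struveL (ν + 1) x / struveL ν x := by
    field_simp
  rw [condNumber_struveL hν hx]
  linarith

end BesselStruve

theorem theorem3p1 (ν x : ℝ) (hx : 0 < x) :
    -- (i) the condition number of `𝐋_ν` in terms of that of `I_ν`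
    ((1 / 2 ≤ ν → condNumber (besselI ν) x < condNumber (struveL ν) x) ∧
      (-(1 / 2) ≤ ν →
        condNumber (struveL ν) x < condNumber (besselI ν) x + 2 * struveB ν x)) ∧
    -- (ii) explicit bounds, first double inequality
    ((1 / 2 ≤ ν →
        Real.sqrt ((ν - 1 / 2) ^ 2 + x ^ 2) - 1 / 2 < condNumber (struveL ν) x) ∧
      (-(1 / 2) ≤ ν →
        condNumber (struveL ν) x <
          Real.sqrt ((ν + struveB ν x) ^ 2 + x ^ 2) + struveB ν x)) ∧
    -- second double inequality
    ((-1 ≤ ν →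
        Real.sqrt ((ν + 1 + struveB (ν + 1) x) ^ 2 + x ^ 2)
            + 2 * struveB ν x - struveB (ν + 1) x - 1 < condNumber (struveL ν) x) ∧
      (-(1 / 2) ≤ ν →
        condNumber (struveL ν) x <
          Real.sqrt ((ν + 1 / 2) ^ 2 + x ^ 2) + 2 * struveB ν x - 1 / 2)) ∧
    -- last lower bound
    (-1 ≤ ν →
      ν + 2 * struveB ν x
          + x ^ 2 / (ν + 1 / 2 + 2 * struveB (ν + 1) x
              + Real.sqrt ((ν + 3 / 2) ^ 2 + x ^ 2)) < condNumber (struveL ν) x) := by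
  refine ⟨⟨fun hν => ?_, fun hν => ?_⟩, ⟨fun hν => ?_, fun hν => ?_⟩,
    ⟨fun hν => ?_, fun hν => ?_⟩, fun hν => ?_⟩
  · exact condNumber_besselI_lt_condNumber_struveL (by linarith) hx
  · exact condNumber_struveL_lt_condNumber_besselI_add (by linarith) hx
  · exact (lt_condNumber_besselI hν hx).trans
      (condNumber_besselI_lt_condNumber_struveL (by linarith) hx)
  · exact condNumber_struveL_lt_sqrt_add (by linarith) hx
  · have h := lt_condNumber_struveL_of_succ_lt (show -(3 / 2) < ν by linarith) hx
      (condNumber_struveL_lt_sqrt_add (show -(3 / 2) < ν + 1 by linarith) hx)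
    have hb := struveB_pos (show -(3 / 2) < ν + 1 by linarith) hx
    have hs := Real.sq_sqrt
      (show 0 ≤ (ν + 1 + struveB (ν + 1) x) ^ 2 + x ^ 2 by positivity)
    have hs0 := Real.sqrt_nonneg ((ν + 1 + struveB (ν + 1) x) ^ 2 + x ^ 2)
    set b := struveB (ν + 1) x
    set s := Real.sqrt ((ν + 1 + b) ^ 2 + x ^ 2)
    have hpos : 0 < s + b + (ν + 1) := by
      have : 0 ≤ ν + 1 := by linarith
      positivity
    -- rationalise: `x ^ 2 = (s - (ν + 1 + b)) (s + (ν + 1 + b))`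
    have e : x ^ 2 / (s + b + (ν + 1)) = s - b - (ν + 1) := by
      rw [div_eq_iff hpos.ne']
      linear_combination -hs
    rw [e] at h
    linarith
  · exact condNumber_struveL_lt_sqrt_add_two_mul hν hx
  · have h := lt_condNumber_struveL_of_succ_lt (show -(3 / 2) < ν by linarith) hx
      (condNumber_struveL_lt_sqrt_add_two_mul (show -(1 / 2) ≤ ν + 1 by linarith) hx)
    convert! h using 3
    rw [show ν + 1 + 1 / 2 = ν + 3 / 2 by ring]
    ring
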